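/- **Theorem 1.3.** A *locally convex space* means a Hausdorff locally convex topological vector space over $\mathbb R$; it is *sequentially complete* if each of its Cauchy sequences converges. Let $\mathbb N_0=\{0,1,2,\dots\}$, let $d\in\mathbb N_0$, let $R\subseteq\mathbb R^d$ have dense interior (i.e. the interior $R^0$ is dense in $R$), let $F$ be a locally convex space and $\ell\in\mathbb N_0\cup\{\infty\}$. Let $C^\ell(R,F)$ be the vector space of all continuous functions $\gamma\colon R\to F$ such that, for each multi-index $\alpha\in\mathbb N_0^d$ with $|\alpha|\le\ell$, the iterated partial derivative $\partial^\alpha(\gamma|_{R^0})\colon R^0\to F$ exists and extends to a (necessarily unique) continuous function $\partial^\alpha\gamma\colon R\to F$. Endow $C^\ell(R,F)$ with the compact-open $C^\ell$-topology, i.e. the initial topology with respect to the maps $C^\ell(R,F)\to C(R,F)$, $\gamma\mapsto\partial^\alpha\gamma$, for $|\alpha|\le\ell$, where the space $C(R,F)$ of continuous functions carries the compact-open topology. Let $\ell\in\mathbb N_0\cup\{\infty\}$ and let $R\subseteq\mathbb R^d$ be a convex subset with dense interior. Assume that the restriction map $$C^\ell(\mathbb R^d,\mathbb R)\to C^\ell(R,\mathbb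 R),\qquad \gamma\mapsto\gamma|_R,$$ has a continuous linear right inverse. Then, for each sequentially complete locally convex space $F$, the restriction map $$C^\ell(\mathbb R^d,F)\to C^\ell(R,F),\qquad \gamma\mapsto\gamma|_R,$$ has a continuous linear right inverse. -/

import Mathlib

open Filter Topology Set

set_option linter.unusedSectionVars false

noncomputable section

namespace CkFun

section General

variable {d : ℕ} {F : Type*} [AddCommGroup F] [Module ℝ F] [TopologicalSpace F]

/-- `v` is the partial derivative at `x` of `f : ℝ^d → F` with respect to the `i`-th variable,
i.e. `v = lim_{t → 0, t ≠ 0} (f (x + t e_i) - f x) / t` in `F`. -/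
def HasPartialAt (i : Fin d) (f : (Fin d → ℝ) → F) (v : F) (x : Fin d → ℝ) : Prop :=
  Tendsto (fun t : ℝ => t⁻¹ • (f (x + t • Pi.single i 1) - f x)) (𝓝[≠] 0) (𝓝 v)

/-- For `L = [i₁, …, i_k]`: on the (open) set `U`, the iterated partial derivative
`∂_{i₁} (∂_{i₂} (⋯ (∂_{i_k} f)))` exists (with all the intermediate derivatives)
and agrees with `g`. -/
def HasIterPartialOn (U : Set (Fin d → ℝ)) :
    List (Fin d) → ((Fin d → ℝ) → F) → ((Fin d → ℝ) → F) → Prop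
  | [], f, g => ∀ x ∈ U, g x = f x
  | i :: L, f, g => ∃ h : (Fin d → ℝ) → F,
      HasIterPartialOn U L f h ∧ ∀ x ∈ U, HasPartialAt i h (g x) x

/-- The order `|α| = α_1 + ⋯ + α_d` of a multi-index `α ∈ ℕ₀^d`. -/
def order (α : Fin d → ℕ) : ℕ := ∑ i, α i

/-- The sequence of variables `1, …, 1, 2, …, 2, …, d, …, d` with `i` repeated `α_i` times, so that
the iterated partial derivative along it is `∂^α = ∂_1^{α_1} ⋯ ∂_d^{α_d}`. -/
def word (α : Fin d → ℕ) : List (Fin d) :=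
  (List.finRange d).flatMap fun i => List.replicate (α i) i

/-- A function on `R ⊆ ℝ^d` viewed as a function on `ℝ^d`, by the irrelevant value `0` off `R`.
It is only differentiated at interior points of `R`. -/
def extendZero {R : Set (Fin d → ℝ)} (f : R → F) : (Fin d → ℝ) → F :=
  Function.extend Subtype.val f 0

/-- `∂^α (f|_{R⁰})` exists on the interior `R⁰` of `R`, and `g : R → F` is a continuous
extension of it to `R`. -/
def IsPartialExt {R : Set (Fin d → ℝ)} (α : Fin d → ℕ) (f : R → F) (g : C(R, F)) : Prop :=
  HasIterPartialOn (interior R) (word α) (extendZero f) (extendZero g)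

lemma extendZero_apply {R : Set (Fin d → ℝ)} (f : R → F) {x : Fin d → ℝ} (hx : x ∈ R) :
    extendZero f x = f ⟨x, hx⟩ :=
  Subtype.val_injective.extend_apply f 0 ⟨x, hx⟩

lemma extendZero_add {R : Set (Fin d → ℝ)} (f g : R → F) :
    extendZero (f + g) = extendZero f + extendZero g := by
  funext x
  by_cases hx : x ∈ R
  · simp [extendZero_apply _ hx]
  · have h : ¬ ∃ a : R, (a : Fin d → ℝ) = x := fun ⟨a, ha⟩ => hx (ha ▸ a.2)
    simp [extendZero, Function.extend_apply' _ _ _ h]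

lemma extendZero_smul {R : Set (Fin d → ℝ)} (c : ℝ) (f : R → F) :
    extendZero (c • f) = c • extendZero f := by
  funext x
  by_cases hx : x ∈ R
  · simp [extendZero_apply _ hx]
  · have h : ¬ ∃ a : R, (a : Fin d → ℝ) = x := fun ⟨a, ha⟩ => hx (ha ▸ a.2)
    simp [extendZero, Function.extend_apply' _ _ _ h]

lemma HasIterPartialOn.mono {U V : Set (Fin d → ℝ)} (hUV : U ⊆ V) {L : List (Fin d)}
    {f g : (Fin d → ℝ) → F} (h : HasIterPartialOn V L f g) : HasIterPartialOn U L f g := by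
  induction L generalizing g with
  | nil => exact fun x hx => h x (hUV hx)
  | cons i L ih =>
    obtain ⟨k, hk, hd⟩ := h
    exact ⟨k, ih hk, fun x hx => hd x (hUV hx)⟩

lemma HasIterPartialOn.congr {U : Set (Fin d → ℝ)} {L : List (Fin d)}
    {f f' g g' : (Fin d → ℝ) → F} (h : HasIterPartialOn U L f g)
    (hf : ∀ x ∈ U, f' x = f x) (hg : ∀ x ∈ U, g' x = g x) : HasIterPartialOn U L f' g' := by
  cases L with
  | nil => exact fun x hx => (hg x hx).trans ((h x hx).trans (hf x hx).symm)
  | cons i L =>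
    obtain ⟨k, hk, hd⟩ := h
    exact ⟨k, hk.congr hf fun _ _ => rfl, fun x hx => (hg x hx).symm ▸ hd x hx⟩

/-- Iterated partial derivatives on an open set are unique. -/
lemma HasIterPartialOn.unique [T2Space F] {U : Set (Fin d → ℝ)} (hU : IsOpen U) {L : List (Fin d)}
    {f g g' : (Fin d → ℝ) → F} (h : HasIterPartialOn U L f g) (h' : HasIterPartialOn U L f g') :
    ∀ x ∈ U, g x = g' x := by
  induction L generalizing g g' with
  | nil => exact fun x hx => (h x hx).trans (h' x hx).symm
  | cons i L ih =>
    obtain ⟨k, hk, hd⟩ := h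
    obtain ⟨k', hk', hd'⟩ := h'
    intro x hx
    refine tendsto_nhds_unique (hd x hx) ((hd' x hx).congr' ?_)
    have hc : Tendsto (fun t : ℝ => x + t • (Pi.single i 1 : Fin d → ℝ)) (𝓝[≠] 0) (𝓝 x) := by
      have : Continuous fun t : ℝ => x + t • (Pi.single i 1 : Fin d → ℝ) := by fun_prop
      exact (this.tendsto' 0 x (by simp)).mono_left nhdsWithin_le_nhds
    filter_upwards [hc.eventually (hU.mem_nhds hx)] with t ht
    rw [ih hk hk' _ ht, ih hk hk' _ hx]

/-- On a regular set, the continuous extension of `∂^α (f|_{R⁰})` is unique. -/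
lemma IsPartialExt.unique [T2Space F] {R : Set (Fin d → ℝ)} (hR : R ⊆ closure (interior R))
    {α : Fin d → ℕ} {f : R → F} {g g' : C(R, F)} (h : IsPartialExt α f g)
    (h' : IsPartialExt α f g') : g = g' := by
  have hD : Dense {x : R | (x : Fin d → ℝ) ∈ interior R} := by
    rw [Subtype.dense_iff]
    intro x hx
    refine closure_mono ?_ (hR hx)
    exact fun y hy => ⟨⟨y, interior_subset hy⟩, hy, rfl⟩
  refine DFunLike.coe_injective (Continuous.ext_on hD g.continuous g'.continuous ?_)
  intro x hx
  have := HasIterPartialOn.unique isOpen_interior h h' x hx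
  rwa [extendZero_apply _ x.2, extendZero_apply _ x.2] at this

end General

section Space

variable {d : ℕ} {F : Type*} [AddCommGroup F] [Module ℝ F] [TopologicalSpace F]
  [IsTopologicalAddGroup F] [ContinuousSMul ℝ F]

lemma HasIterPartialOn.zero (U : Set (Fin d → ℝ)) (L : List (Fin d)) :
    HasIterPartialOn U L (0 : (Fin d → ℝ) → F) 0 := by
  induction L with
  | nil => exact fun _ _ => rfl
  | cons i L ih => exact ⟨0, ih, fun x _ => by simpa [HasPartialAt] using tendsto_const_nhds⟩

lemma HasIterPartialOn.add {U : Set (Fin d → ℝ)} {L : List (Fin d)}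
    {f g f' g' : (Fin d → ℝ) → F} (h : HasIterPartialOn U L f g)
    (h' : HasIterPartialOn U L f' g') : HasIterPartialOn U L (f + f') (g + g') := by
  induction L generalizing g g' with
  | nil => exact fun x hx => by simp [h x hx, h' x hx]
  | cons i L ih =>
    obtain ⟨k, hk, hd⟩ := h
    obtain ⟨k', hk', hd'⟩ := h'
    refine ⟨k + k', ih hk hk', fun x hx => ((hd x hx).add (hd' x hx)).congr fun t => ?_⟩
    simp only [Pi.add_apply, ← smul_add]
    congr 1
    abel

lemma HasIterPartialOn.smul {U : Set (Fin d → ℝ)} {L : List (Fin d)} (c : ℝ)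
    {f g : (Fin d → ℝ) → F} (h : HasIterPartialOn U L f g) :
    HasIterPartialOn U L (c • f) (c • g) := by
  induction L generalizing g with
  | nil => exact fun x hx => by simp [h x hx]
  | cons i L ih =>
    obtain ⟨k, hk, hd⟩ := h
    refine ⟨c • k, ih hk, fun x hx => ((hd x hx).const_smul c).congr fun t => ?_⟩
    simp only [Pi.smul_apply, ← smul_sub]
    rw [smul_comm]

/-- The vector space of all continuous `f : R → F` such that, for every multi-index `α` with
`|α| ≤ ℓ`, the partial derivative `∂^α (f|_{R⁰})` exists and has a continuous extension `R → F`. -/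
def ckSubmodule (ℓ : ℕ∞) (R : Set (Fin d → ℝ)) (F : Type*) [AddCommGroup F] [Module ℝ F]
    [TopologicalSpace F] [IsTopologicalAddGroup F] [ContinuousSMul ℝ F] :
    Submodule ℝ C(R, F) where
  carrier := {f | ∀ α : Fin d → ℕ, (order α : ℕ∞) ≤ ℓ → ∃ g : C(R, F), IsPartialExt α f g}
  zero_mem' := fun α _ => ⟨0, by
    have h0 : extendZero (⇑(0 : C(R, F))) = 0 := by
      simpa using extendZero_smul (0 : ℝ) (⇑(0 : C(R, F)))
    rw [IsPartialExt, h0]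
    exact HasIterPartialOn.zero _ _⟩
  add_mem' := fun {a b} ha hb α hα => by
    obtain ⟨g, hg⟩ := ha α hα
    obtain ⟨g', hg'⟩ := hb α hα
    refine ⟨g + g', ?_⟩
    rw [IsPartialExt, ContinuousMap.coe_add, ContinuousMap.coe_add, extendZero_add, extendZero_add]
    exact HasIterPartialOn.add hg hg'
  smul_mem' := fun c f hf α hα => by
    obtain ⟨g, hg⟩ := hf α hα
    refine ⟨c • g, ?_⟩
    rw [IsPartialExt, ContinuousMap.coe_smul, ContinuousMap.coe_smul, extendZero_smul,
      extendZero_smul]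
    exact HasIterPartialOn.smul c hg

/-- The space `C^ℓ(R, F)`, for `ℓ ∈ ℕ₀ ∪ {∞}` and a regular set `R ⊆ ℝ^d`. (This is a type of its
own, since it does not carry the topology induced by `C(R, F)`.) -/
def CSpace (ℓ : ℕ∞) (R : Set (Fin d → ℝ)) (F : Type*) [AddCommGroup F] [Module ℝ F]
    [TopologicalSpace F] [IsTopologicalAddGroup F] [ContinuousSMul ℝ F] : Type _ :=
  ↥(ckSubmodule ℓ R F)

variable {ℓ : ℕ∞} {R : Set (Fin d → ℝ)}

instance : AddCommGroup (CSpace ℓ R F) := inferInstanceAs (AddCommGroup ↥(ckSubmodule ℓ R F))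

instance : Module ℝ (CSpace ℓ R F) := inferInstanceAs (Module ℝ ↥(ckSubmodule ℓ R F))

/-- The inclusion `C^ℓ(R, F) → C(R, F)`. -/
def CSpace.toCont : CSpace ℓ R F →ₗ[ℝ] C(R, F) := (ckSubmodule ℓ R F).subtype

/-- The continuous extension `∂^α γ : R → F` of `∂^α (γ|_{R⁰})`. -/
def CSpace.pderiv (α : Fin d → ℕ) (hα : (order α : ℕ∞) ≤ ℓ) (γ : CSpace ℓ R F) : C(R, F) :=
  (γ.2 α hα).choose

lemma CSpace.pderiv_spec (α : Fin d → ℕ) (hα : (order α : ℕ∞) ≤ ℓ) (γ : CSpace ℓ R F) :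
    IsPartialExt α γ.toCont (γ.pderiv α hα) :=
  (γ.2 α hα).choose_spec

/-- The compact-open `C^ℓ`-topology: the initial topology with respect to the maps
`∂^α : C^ℓ(R, F) → C(R, F)`, `|α| ≤ ℓ`, where `C(R, F)` has the compact-open topology. -/
instance : TopologicalSpace (CSpace ℓ R F) :=
  ⨅ (α : Fin d → ℕ) (hα : (order α : ℕ∞) ≤ ℓ),
    TopologicalSpace.induced (CSpace.pderiv α hα) ContinuousMap.compactOpen

lemma restrict_mem {S : Set (Fin d → ℝ)} (h : R ⊆ S) (γ : CSpace ℓ S F) :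
    γ.toCont.comp (ContinuousMap.inclusion h) ∈ ckSubmodule ℓ R F := by
  intro α hα
  refine ⟨(γ.pderiv α hα).comp (ContinuousMap.inclusion h), ?_⟩
  refine ((γ.pderiv_spec α hα).mono (interior_mono h)).congr ?_ ?_ <;>
  · intro x hx
    rw [extendZero_apply _ (interior_subset hx), extendZero_apply _ (h (interior_subset hx))]
    rfl

/-- The restriction map `C^ℓ(S, F) → C^ℓ(R, F)`, `γ ↦ γ|_R`, for `R ⊆ S`. -/
def restrictMap (ℓ : ℕ∞) {R S : Set (Fin d → ℝ)} (h : R ⊆ S) (F : Type*) [AddCommGroup F]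
    [Module ℝ F] [TopologicalSpace F] [IsTopologicalAddGroup F] [ContinuousSMul ℝ F] :
    CSpace ℓ S F →ₗ[ℝ] CSpace ℓ R F where
  toFun γ := ⟨γ.toCont.comp (ContinuousMap.inclusion h), restrict_mem h γ⟩
  map_add' _ _ := rfl
  map_smul' _ _ := rfl

/-- The restriction map `C^ℓ(ℝ^d, F) → C^ℓ(R, F)` has a continuous linear right inverse. -/
def HasExtensionOperator (ℓ : ℕ∞) (R : Set (Fin d → ℝ)) (F : Type*) [AddCommGroup F]
    [Module ℝ F] [TopologicalSpace F] [IsTopologicalAddGroup F] [ContinuousSMul ℝ F] : Prop :=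
  ∃ E : CSpace ℓ R F →L[ℝ] CSpace ℓ univ F,
    ∀ γ : CSpace ℓ R F, restrictMap ℓ (subset_univ R) F (E γ) = γ

end Space

end CkFun

end

/-! ### Seminorms and continuous functionals on a locally convex space -/

section LocallyConvex

variable {F : Type*} [AddCommGroup F] [Module ℝ F] [TopologicalSpace F] [IsTopologicalAddGroup F]
  [ContinuousSMul ℝ F] [LocallyConvexSpace ℝ F]

/-! Let `E` be the scalar extension operator. The extension of `γ` and its derivatives should be
vectors `W α γ x` with `l (W α γ x) = ∂^α (E (l ∘ γ)) x` for every continuous functional `l` on `F`.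
Functionals separate points, so such vectors are unique, hence linear in `γ`, and the extension
property is inherited from `E`.

Existence: `f ↦ ∂^α (E f) x` is bounded by finitely many derivatives of `f` on a compact set `L`, so
by Hahn-Banach it comes from a functional `Φ` on `C(Z, ℝ)`, where `Z` is a finite disjoint union of
copies of `L`. Such a `Φ` can be applied to a function `Z → F` as a limit of Riemann sums; since `Z`
is metrizable, a sequence of sums is enough, hence sequential completeness
(`exists_forall_dual_eq_functional`, `exists_forall_dual_eq_compDual`).

Regularity: the functionals dominated by a continuous seminorm are totally bounded on compact sets,
which upgrades weak continuity of `W α γ` to continuity (`continuous_of_dual_eq_pderivAt`). The mean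
value inequality then turns weak partial derivatives into genuine ones
(`hasPartialAt_of_forall_dual`). Continuity in `γ` follows from the scalar bound for `E`, which is
uniform in `l` (`eventually_mapsTo_of_dual_eq_pderivAt`). -/

lemma LocallyConvexSpace.exists_seminorm_ball_subset {U : Set F} (hU : U ∈ 𝓝 (0 : F)) :
    ∃ p : Seminorm ℝ F, Continuous p ∧ ∃ r > 0, ∀ v, p v < r → v ∈ U := by
  obtain ⟨s, r, hr, h⟩ := ((PolynormableSpace.withSeminorms ℝ F).mem_nhds_iff 0 U).1 hU
  refine ⟨_, Seminorm.continuous_finsetSup (s := s) (fun i _ => i.2), r, hr, fun v hv => h ?_⟩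
  rwa [Seminorm.mem_ball_zero]

/-- A continuous seminorm is attained by a continuous functional which it dominates. -/
lemma Seminorm.exists_dual_eq {p : Seminorm ℝ F} (hp : Continuous p) (v : F) :
    ∃ l : F →L[ℝ] ℝ, (∀ w, |l w| ≤ p w) ∧ l v = p v := by
  rcases eq_or_ne v 0 with rfl | hv
  · exact ⟨0, fun w => by simp, by simp⟩
  let f : Module.Dual ℝ (ℝ ∙ v) :=
    p v • (LinearEquiv.toSpanNonzeroSingleton ℝ F v hv).symm.toLinearMap
  obtain ⟨g, hg, hle⟩ := Module.Dual.exists_continuous_extension_of_le_seminorm_real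
    (ℝ ∙ v) f hp (by
      intro x
      obtain ⟨c, rfl⟩ := (LinearEquiv.toSpanNonzeroSingleton ℝ F v hv).surjective x
      have hf : f (LinearEquiv.toSpanNonzeroSingleton ℝ F v hv c) = p v * c :=
        congrArg (p v * ·) (LinearEquiv.symm_apply_apply _ c)
      rw [hf, LinearEquiv.toSpanNonzeroSingleton_apply, map_smul_eq_mul, mul_comm]
      exact mul_le_mul_of_nonneg_right (le_abs_self c) (apply_nonneg p v))
  refine ⟨g, hle, ?_⟩
  have h1 := hg ⟨v, Submodule.mem_span_singleton_self v⟩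
  have h2 : (LinearEquiv.toSpanNonzeroSingleton ℝ F v hv).symm
      ⟨v, Submodule.mem_span_singleton_self v⟩ = 1 := by
    rw [LinearEquiv.symm_apply_eq]
    ext
    simp [LinearEquiv.toSpanNonzeroSingleton_apply]
  simpa [f, h2] using h1

/-- By Hahn-Banach, an estimate in `F` reduces to scalar estimates that are uniform over the
functionals dominated by `p`. -/
lemma Seminorm.le_of_forall_dual_le {p : Seminorm ℝ F} (hp : Continuous p) {v : F} {C : ℝ}
    (h : ∀ l : F →L[ℝ] ℝ, (∀ w, |l w| ≤ p w) → |l v| ≤ C) : p v ≤ C := by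
  obtain ⟨l, hl, hv⟩ := Seminorm.exists_dual_eq hp v
  exact hv ▸ (le_abs_self _).trans (h l hl)

lemma eq_of_forall_dual_eq [T2Space F] {v w : F} (h : ∀ l : F →L[ℝ] ℝ, l v = l w) : v = w := by
  by_contra hne
  obtain ⟨p, hp, r, hr, hU⟩ := LocallyConvexSpace.exists_seminorm_ball_subset
    (isOpen_compl_singleton.mem_nhds (Ne.symm (sub_ne_zero.2 hne)) :
      ({v - w}ᶜ : Set F) ∈ 𝓝 (0 : F))
  refine hU (v - w) (lt_of_le_of_lt ?_ hr) rfl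
  exact Seminorm.le_of_forall_dual_le hp fun l _ => by simp [h l]

/-- The functionals dominated by a continuous seminorm are totally bounded for the topology of
uniform convergence on compact sets. -/
lemma Seminorm.exists_finite_dual_net {p : Seminorm ℝ F} (hp : Continuous p) {Q : Set F}
    (hQ : IsCompact Q) {ε : ℝ} (hε : 0 < ε) :
    ∃ T : Set (F →L[ℝ] ℝ), T.Finite ∧
      ∀ l : F →L[ℝ] ℝ, (∀ w, |l w| ≤ p w) →
        ∃ l' ∈ T, ∀ y ∈ Q, |l y - l' y| ≤ ε := by
  -- Moving a point of `Q` to a nearby centre in `t` costs at most `ε / 3` for each of `l` and `l'`;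
  -- the last third is their distance on the centres.
  obtain ⟨t, -, ht⟩ := hQ.elim_nhds_subcover (fun y => {z | p (z - y) < ε / 3}) fun y _ => by
    refine IsOpen.mem_nhds ?_ (by simpa using by positivity)
    exact isOpen_lt (hp.comp (continuous_id.sub continuous_const)) continuous_const
  let ev : (F →L[ℝ] ℝ) → (t → ℝ) := fun l y => l y
  let P : Set (F →L[ℝ] ℝ) := {l | ∀ w, |l w| ≤ p w}
  have hb : TotallyBounded (ev '' P) := by
    refine TotallyBounded.subset ?_ (isCompact_univ_pi
      (s := fun y : t => Icc (-p (y : F)) (p (y : F))) fun y => isCompact_Icc).totallyBounded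
    rintro _ ⟨l, hl, rfl⟩ y -
    exact abs_le.1 (hl y)
  obtain ⟨s, hs, hsf, hcov⟩ :=
    (totallyBounded_iff_subset.1 hb) _ (Metric.dist_mem_uniformity (by positivity : 0 < ε / 3))
  -- The net is lifted to functionals in `P`, so that its members are dominated by `p` as well.
  obtain ⟨T, hTP, hTf, rfl⟩ := (Set.exists_subset_image_finite_and
    (p := fun u => u = s) (f := ev) (s := P)).1 ⟨s, hs, hsf, rfl⟩
  refine ⟨T, hTf, fun l hl => ?_⟩
  have := hcov ⟨l, hl, rfl⟩
  simp only [mem_iUnion, mem_image] at this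
  obtain ⟨_, ⟨l', hl', rfl⟩, hd⟩ := this
  refine ⟨l', hl', fun y hy => ?_⟩
  have hy' := ht hy
  simp only [mem_iUnion] at hy'
  obtain ⟨z, hz, hyz⟩ := hy'
  have h1 : |l (y - z)| ≤ p (y - z) := hl _
  have h2 : |l' (y - z)| ≤ p (y - z) := hTP hl' _
  have h3 : |l z - l' z| < ε / 3 := lt_of_le_of_lt (dist_le_pi_dist (ev l) (ev l') ⟨z, hz⟩) hd
  rw [map_sub] at h1 h2
  have hyz' : p (y - z) < ε / 3 := hyz
  rw [abs_le] at h1 h2 ⊢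
  rw [abs_lt] at h3
  constructor <;> linarith [h1.1, h1.2, h2.1, h2.2, h3.1, h3.2]

end LocallyConvex

/-! ### Applying a functional on `C(Z, ℝ)` to vector-valued functions -/

section VectorValued

lemma exists_partition_of_dist_lt (Z : Type*) [MetricSpace Z] [CompactSpace Z] {δ : ℝ}
    (hδ : 0 < δ) :
    ∃ (n : ℕ) (φ : Fin n → C(Z, ℝ)) (z : Fin n → Z), (∀ i x, φ i x ≠ 0 → dist x (z i) < δ) ∧
      (∀ i x, 0 ≤ φ i x) ∧ ∀ x, ∑ i, φ i x = 1 := by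
  obtain ⟨t, -, htf, ht⟩ := finite_cover_balls_of_compact (isCompact_univ (X := Z)) hδ
  let e := htf.toFinset.equivFin.symm
  obtain ⟨φ, h1, h2, h3⟩ := exists_continuous_sum_one_of_isOpen_isCompact
    (s := fun i => Metric.ball ((e i : Z)) δ) (fun i => Metric.isOpen_ball) isCompact_univ (by
      intro x hx
      obtain ⟨y, hy, hxy⟩ := mem_iUnion₂.1 (ht hx)
      exact mem_iUnion.2 ⟨e.symm ⟨y, htf.mem_toFinset.2 hy⟩, by simpa using hxy⟩)
  refine ⟨_, φ, fun i => e i, fun i x hx => ?_, fun i x => (h3.1 i x).1, fun x => ?_⟩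
  · exact h1 i (subset_tsupport _ hx)
  · simpa using h2 (mem_univ x)

variable {F : Type*} [AddCommGroup F] [Module ℝ F]

/-- Applying `l` to the Riemann sum gives `Φ` of `∑ l (g (z i)) φ i`, which is uniformly within `η`
of `l ∘ g`. The bound depends on `l` only through `η`, so it is uniform over functionals dominated
by one seminorm. -/
lemma abs_functional_sub_le [TopologicalSpace F] {Z : Type*} [MetricSpace Z] [CompactSpace Z]
    (Φ : C(Z, ℝ) →L[ℝ] ℝ) (g : C(Z, F)) (l : F →L[ℝ] ℝ) {δ η : ℝ} (hη : 0 ≤ η)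
    (h : ∀ x y, dist x y < δ → |l (g x) - l (g y)| ≤ η)
    {n : ℕ} {φ : Fin n → C(Z, ℝ)} {z : Fin n → Z} (hφ : ∀ i x, φ i x ≠ 0 → dist x (z i) < δ)
    (h0 : ∀ i x, 0 ≤ φ i x) (h1 : ∀ x, ∑ i, φ i x = 1) :
    |Φ ((l : C(F, ℝ)).comp g) - l (∑ i, Φ (φ i) • g (z i))| ≤ ‖Φ‖ * η := by
  have : l (∑ i, Φ (φ i) • g (z i)) = Φ (∑ i, l (g (z i)) • φ i) := by
    simp [map_sum, mul_comm]
  rw [this, ← map_sub, ← Real.norm_eq_abs]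
  refine (Φ.le_opNorm _).trans (mul_le_mul_of_nonneg_left ?_ (norm_nonneg _))
  rw [ContinuousMap.norm_le _ hη]
  intro x
  have : ((l : C(F, ℝ)).comp g - ∑ i, l (g (z i)) • φ i) x
      = ∑ i, φ i x * (l (g x) - l (g (z i))) := by
    simp only [mul_sub, Finset.sum_sub_distrib, ← Finset.sum_mul, h1, one_mul]
    simp [mul_comm]
  rw [this, Real.norm_eq_abs]
  calc |∑ i, φ i x * (l (g x) - l (g (z i)))|
      ≤ ∑ i, |φ i x * (l (g x) - l (g (z i)))| := Finset.abs_sum_le_sum_abs _ _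
    _ ≤ ∑ i, φ i x * η := by
        refine Finset.sum_le_sum fun i _ => ?_
        rw [abs_mul, abs_of_nonneg (h0 i x)]
        by_cases hx : φ i x = 0
        · simp [hx]
        · exact mul_le_mul_of_nonneg_left (h _ _ (hφ i x hx)) (h0 i x)
    _ = η := by rw [← Finset.sum_mul, h1, one_mul]

/-- A continuous functional on `C(Z, ℝ)`, with `Z` a compact metric space, can be applied to
continuous functions with values in a sequentially complete locally convex space. -/
lemma exists_forall_dual_eq_functional [UniformSpace F] [IsUniformAddGroup F] [ContinuousSMul ℝ F]
    [LocallyConvexSpace ℝ F] (hF : ∀ u : ℕ → F, CauchySeq u → ∃ v, Tendsto u atTop (𝓝 v))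
    {Z : Type*} [MetricSpace Z] [CompactSpace Z] (Φ : C(Z, ℝ) →L[ℝ] ℝ) (g : C(Z, F)) :
    ∃ v : F, ∀ l : F →L[ℝ] ℝ, l v = Φ ((l : C(F, ℝ)).comp g) := by
  have hg : UniformContinuous g := CompactSpace.uniformContinuous_of_continuous g.continuous
  choose n φ z hφ h0 h1 using fun k : ℕ =>
    exists_partition_of_dist_lt Z (Nat.one_div_pos_of_nat (α := ℝ) (n := k))
  let v : ℕ → F := fun k => ∑ i, Φ (φ k i) • g (z k i)
  -- `N` does not depend on `l`; this makes the Riemann sums Cauchy in `F` and not only weakly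
  -- Cauchy.
  have key : ∀ p : Seminorm ℝ F, Continuous p → ∀ ε > 0, ∃ N, ∀ k ≥ N, ∀ l : F →L[ℝ] ℝ,
      (∀ w, |l w| ≤ p w) → |Φ ((l : C(F, ℝ)).comp g) - l (v k)| ≤ ε := by
    intro p hp ε hε
    -- The `+ 1` covers the case `‖Φ‖ = 0`.
    have hU : {q : F × F | p (q.2 - q.1) < ε / (‖Φ‖ + 1)} ∈ uniformity F := by
      rw [uniformity_eq_comap_nhds_zero F]
      refine ⟨{w | p w < ε / (‖Φ‖ + 1)}, ?_, fun q hq => hq⟩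
      exact (isOpen_lt hp continuous_const).mem_nhds (by simpa using by positivity)
    obtain ⟨δ, hδ, hd⟩ := Metric.mem_uniformity_dist.1 (hg hU)
    obtain ⟨N, hN⟩ := exists_nat_one_div_lt hδ
    refine ⟨N, fun k hk l hl => ?_⟩
    refine (abs_functional_sub_le Φ g l (η := ε / (‖Φ‖ + 1)) (by positivity) (fun x y hxy => ?_)
      (hφ k) (h0 k) (h1 k)).trans ?_
    · rw [← map_sub, ← abs_neg, ← map_neg, neg_sub]
      exact (hl _).trans (le_of_lt (hd (hxy.trans_le ((Nat.one_div_le_one_div hk).trans hN.le))))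
    · rw [mul_div_assoc', div_le_iff₀ (by positivity)]
      nlinarith [norm_nonneg Φ]
  have hc : CauchySeq v := by
    rw [cauchySeq_iff]
    intro V hV
    rw [uniformity_eq_comap_nhds_zero F] at hV
    obtain ⟨U, hU, hUV⟩ := hV
    obtain ⟨p, hp, r, hr, hpU⟩ := LocallyConvexSpace.exists_seminorm_ball_subset hU
    obtain ⟨N, hN⟩ := key p hp (r / 3) (by positivity)
    refine ⟨N, fun k hk m hm => hUV (hpU _ (lt_of_le_of_lt ?_ (by linarith : 2 * (r / 3) < r)))⟩
    refine Seminorm.le_of_forall_dual_le hp fun l hl => ?_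
    have a := abs_le.1 (hN k hk l hl)
    have b := abs_le.1 (hN m hm l hl)
    rw [map_sub, abs_le]
    constructor <;> linarith [a.1, a.2, b.1, b.2]
  obtain ⟨w, hw⟩ := hF v hc
  refine ⟨w, fun l => tendsto_nhds_unique ((l.continuous.tendsto w).comp hw) ?_⟩
  rw [Metric.tendsto_atTop']
  intro ε hε
  -- For a fixed `l`, the seminorm `|l|` dominates `l` itself.
  let p : Seminorm ℝ F := (normSeminorm ℝ ℝ).comp l.toLinearMap
  have hpc : Continuous p := l.continuous.norm
  obtain ⟨N, hN⟩ := key p hpc (ε / 2) (by positivity)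
  refine ⟨N, fun k hk => ?_⟩
  rw [dist_comm, Real.dist_eq]
  exact lt_of_le_of_lt (hN k hk.le l fun _ => le_rfl) (by linarith)

end VectorValued

namespace CkFun

/-! ### Words of multi-indices -/

section Words

/-- The letter `i` is the first one of `l` with `α i ≠ 0`. As `l` has no repetition, lowering `α i`
shortens only that block. -/
lemma flatMap_replicate_eq_cons {ι : Type*} [DecidableEq ι] (α : ι → ℕ) {l L : List ι} {i : ι}
    (hl : l.Nodup) (h : (l.flatMap fun j => List.replicate (α j) j) = i :: L) :
    L = l.flatMap fun j => List.replicate (Function.update α i (α i - 1) j) j := by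
  induction l with
  | nil => simp at h
  | cons a l ih =>
    rw [List.nodup_cons] at hl
    rw [List.flatMap_cons] at h ⊢
    cases ha : α a with
    | zero =>
      have h0 : Function.update α i (α i - 1) a = 0 := by
        rcases eq_or_ne a i with rfl | hai
        · simp [ha]
        · simp [hai, ha]
      rw [ha, List.replicate_zero, List.nil_append] at h
      rw [h0, List.replicate_zero, List.nil_append]
      exact ih hl.2 h
    | succ k =>
      rw [ha, List.replicate_succ, List.cons_append, List.cons.injEq] at h
      obtain ⟨rfl, rfl⟩ := h
      rw [Function.update_self, ha, Nat.add_sub_cancel]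
      congr 1
      refine List.flatMap_congr fun j hj => ?_
      rw [Function.update_of_ne]
      rintro rfl
      exact hl.1 hj

/-- Dropping the first letter of the word of a multi-index gives the word of a smaller one. -/
lemma exists_word_eq_tail {d : ℕ} {α : Fin d → ℕ} {i : Fin d} {L : List (Fin d)}
    (h : word α = i :: L) : ∃ β : Fin d → ℕ, L = word β ∧ order β ≤ order α := by
  refine ⟨_, flatMap_replicate_eq_cons α (List.nodup_finRange d) h,
    Finset.sum_le_sum fun j _ => ?_⟩
  rcases eq_or_ne j i with rfl | hj
  · simp
  · simp [hj]

lemma word_zero {d : ℕ} : word (0 : Fin d → ℕ) = [] := by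
  simp [word]

lemma order_zero_le {d : ℕ} (ℓ : ℕ∞) : (order (0 : Fin d → ℕ) : ℕ∞) ≤ ℓ := by
  simp [order]

end Words

/-! ### Derivatives as linear maps and the seminorm bounds for `E` -/

section Pderiv

variable {d : ℕ} {F : Type*} [AddCommGroup F] [Module ℝ F] [TopologicalSpace F]
  [IsTopologicalAddGroup F] [ContinuousSMul ℝ F] {ℓ : ℕ∞} {R : Set (Fin d → ℝ)}

lemma CSpace.ext {f g : CSpace ℓ R F} (h : ∀ x, f.toCont x = g.toCont x) : f = g :=
  Subtype.ext (ContinuousMap.ext h)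

/-- The linear map `∂^α : C^ℓ(R, F) → C(R, F)`. -/
noncomputable def pderivₗ [T2Space F] (hR : R ⊆ closure (interior R)) (α : Fin d → ℕ)
    (hα : (order α : ℕ∞) ≤ ℓ) : CSpace ℓ R F →ₗ[ℝ] C(R, F) where
  toFun γ := γ.pderiv α hα
  map_add' γ η := by
    refine IsPartialExt.unique hR ((γ + η).pderiv_spec α hα) ?_
    rw [IsPartialExt, map_add, ContinuousMap.coe_add, ContinuousMap.coe_add, extendZero_add,
      extendZero_add]
    exact (γ.pderiv_spec α hα).add (η.pderiv_spec α hα)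
  map_smul' c γ := by
    refine IsPartialExt.unique hR ((c • γ).pderiv_spec α hα) ?_
    rw [IsPartialExt, map_smul, RingHom.id_apply, ContinuousMap.coe_smul, ContinuousMap.coe_smul,
      extendZero_smul, extendZero_smul]
    exact (γ.pderiv_spec α hα).smul c

lemma pderivₗ_apply [T2Space F] (hR : R ⊆ closure (interior R)) (α : Fin d → ℕ)
    (hα : (order α : ℕ∞) ≤ ℓ) (γ : CSpace ℓ R F) : pderivₗ hR α hα γ = γ.pderiv α hα := rfl

lemma continuous_pderiv (α : Fin d → ℕ) (hα : (order α : ℕ∞) ≤ ℓ) :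
    Continuous (CSpace.pderiv α hα : CSpace ℓ R F → C(R, F)) :=
  continuous_iff_le_induced.2 (iInf₂_le α hα)

lemma isTopologicalAddGroup_cSpace [T2Space F] (hR : R ⊆ closure (interior R)) :
    IsTopologicalAddGroup (CSpace ℓ R F) :=
  topologicalAddGroup_iInf fun α => topologicalAddGroup_iInf fun hα =>
    topologicalAddGroup_induced (pderivₗ hR α hα : CSpace ℓ R F →ₗ[ℝ] C(R, F))

/-- Neighbourhoods of `0` in `C^ℓ(R, F)` are given by finitely many derivatives on a compact
set. -/
lemma exists_pderiv_mem_subset [T2Space F] (hR : R ⊆ closure (interior R))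
    {U : Set (CSpace ℓ R F)} (hU : U ∈ 𝓝 0) :
    ∃ (S : Finset {α : Fin d → ℕ // (order α : ℕ∞) ≤ ℓ}) (L : Set R) (V : Set F), IsCompact L ∧
      V ∈ 𝓝 0 ∧ ∀ f : CSpace ℓ R F, (∀ β ∈ S, ∀ y ∈ L, f.pderiv β.1 β.2 y ∈ V) → f ∈ U := by
  have hnhds : 𝓝 (0 : CSpace ℓ R F) = ⨅ α : {α : Fin d → ℕ // (order α : ℕ∞) ≤ ℓ},
      comap (CSpace.pderiv α.1 α.2) (𝓝 (ContinuousMap.const R (0 : F))) := by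
    rw [iInf_subtype]
    refine (nhds_iInf (a := (0 : CSpace ℓ R F))).trans (iInf_congr fun α => ?_)
    refine (nhds_iInf (a := (0 : CSpace ℓ R F))).trans (iInf_congr fun hα => ?_)
    rw [nhds_induced]
    congr 2
    exact map_zero (pderivₗ hR α hα)
  rw [hnhds] at hU
  obtain ⟨⟨I, B⟩, ⟨hI, hB⟩, hsub⟩ := (HasBasis.iInf fun α : {α : Fin d → ℕ // (order α : ℕ∞) ≤ ℓ} =>
    ((𝓝 (0 : F)).basis_sets.nhds_continuousMapConst (X := R)).comap
      (CSpace.pderiv α.1 α.2 : CSpace ℓ R F → C(R, F))).mem_iff.1 hU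
  have := hI.to_subtype
  refine ⟨hI.toFinset, ⋃ i : I, (B i).1, ⋂ i : I, (B i).2, isCompact_iUnion fun i => (hB i).1,
    iInter_mem.2 fun i => (hB i).2, fun f hf => hsub ?_⟩
  refine mem_iInter.2 fun i y hy => ?_
  exact mem_iInter.1 (hf i (hI.mem_toFinset.2 i.2) y (mem_iUnion.2 ⟨i, hy⟩)) i

lemma HasIterPartialOn.clm_comp {G : Type*} [AddCommGroup G] [Module ℝ G] [TopologicalSpace G]
    (l : F →L[ℝ] G) {U : Set (Fin d → ℝ)} {L : List (Fin d)} {f g : (Fin d → ℝ) → F}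
    (h : HasIterPartialOn U L f g) : HasIterPartialOn U L (l ∘ f) (l ∘ g) := by
  induction L generalizing g with
  | nil => exact fun x hx => congrArg l (h x hx)
  | cons i L ih =>
    obtain ⟨k, hk, hd⟩ := h
    refine ⟨l ∘ k, ih hk, fun x hx => ?_⟩
    refine ((l.continuous.tendsto _).comp (hd x hx)).congr fun t => ?_
    simp

lemma IsPartialExt.clm_comp {G : Type*} [AddCommGroup G] [Module ℝ G] [TopologicalSpace G]
    (l : F →L[ℝ] G) {α : Fin d → ℕ} {f : R → F} {g : C(R, F)} (h : IsPartialExt α f g) :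
    IsPartialExt α (l ∘ f) ((l : C(F, G)).comp g) := by
  refine (HasIterPartialOn.clm_comp l h).congr ?_ ?_ <;>
  · intro x hx
    simp [extendZero_apply _ (interior_subset hx)]

/-- The map `C^ℓ(R, F) → C^ℓ(R, ℝ)`, `γ ↦ l ∘ γ`, for a continuous functional `l` on `F`. -/
noncomputable def compDual (l : F →L[ℝ] ℝ) : CSpace ℓ R F →ₗ[ℝ] CSpace ℓ R ℝ where
  toFun γ := ⟨(l : C(F, ℝ)).comp γ.toCont, fun α hα => ⟨_, (γ.pderiv_spec α hα).clm_comp l⟩⟩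
  map_add' γ η := CSpace.ext fun x => l.map_add (γ.toCont x) (η.toCont x)
  map_smul' c γ := CSpace.ext fun x => l.map_smul c (γ.toCont x)

lemma compDual_sub (l l' : F →L[ℝ] ℝ) (γ : CSpace ℓ R F) :
    compDual (l - l') γ = compDual l γ - compDual l' γ := rfl

lemma pderiv_compDual (hR : R ⊆ closure (interior R)) (l : F →L[ℝ] ℝ) (γ : CSpace ℓ R F)
    (α : Fin d → ℕ) (hα : (order α : ℕ∞) ≤ ℓ) :
    (compDual l γ).pderiv α hα = (l : C(F, ℝ)).comp (γ.pderiv α hα) :=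
  IsPartialExt.unique hR ((compDual l γ).pderiv_spec α hα) ((γ.pderiv_spec α hα).clm_comp l)

lemma univ_subset_closure_interior : (univ : Set (Fin d → ℝ)) ⊆ closure (interior univ) := by
  simp

/-- The partial derivative `∂^α f` at the point `x`, as a linear functional of `f`. -/
noncomputable def pderivAt (α : Fin d → ℕ) (hα : (order α : ℕ∞) ≤ ℓ) (x : Fin d → ℝ) :
    CSpace ℓ (univ : Set (Fin d → ℝ)) ℝ →ₗ[ℝ] ℝ where
  toFun f := f.pderiv α hα ⟨x, mem_univ x⟩
  map_add' f g := by
    rw [← pderivₗ_apply univ_subset_closure_interior, map_add]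
    rfl
  map_smul' c f := by
    rw [← pderivₗ_apply univ_subset_closure_interior, map_smul]
    rfl

lemma pderivAt_eq_extendZero (α : Fin d → ℕ) (hα : (order α : ℕ∞) ≤ ℓ)
    (f : CSpace ℓ (univ : Set (Fin d → ℝ)) ℝ) :
    (fun x => pderivAt α hα x f) = extendZero (f.pderiv α hα) :=
  funext fun x => (extendZero_apply _ (mem_univ x)).symm

lemma continuous_pderivAt (α : Fin d → ℕ) (hα : (order α : ℕ∞) ≤ ℓ)
    (f : CSpace ℓ (univ : Set (Fin d → ℝ)) ℝ) : Continuous fun x => pderivAt α hα x f :=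
  (f.pderiv α hα).continuous.comp (by fun_prop)

lemma pderivAt_of_word_eq_nil {α : Fin d → ℕ} (hα : (order α : ℕ∞) ≤ ℓ) (h : word α = [])
    (f : CSpace ℓ (univ : Set (Fin d → ℝ)) ℝ) (x : Fin d → ℝ) :
    pderivAt α hα x f = f.toCont ⟨x, mem_univ x⟩ := by
  have := f.pderiv_spec α hα
  rw [IsPartialExt, h] at this
  have := this x (by simp)
  rwa [extendZero_apply _ (mem_univ x), extendZero_apply _ (mem_univ x)] at this

/-- The intermediate function in the iterated derivative along `word α` must be `∂^β f`, by
uniqueness of iterated derivatives on all of `ℝ^d`. -/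
lemma hasPartialAt_pderivAt {α β : Fin d → ℕ} {i : Fin d} (hα : (order α : ℕ∞) ≤ ℓ)
    (hβ : (order β : ℕ∞) ≤ ℓ) (h : word α = i :: word β)
    (f : CSpace ℓ (univ : Set (Fin d → ℝ)) ℝ) (x : Fin d → ℝ) :
    HasPartialAt i (fun y => pderivAt β hβ y f) (pderivAt α hα x f) x := by
  have hs := f.pderiv_spec α hα
  rw [IsPartialExt, h] at hs
  obtain ⟨k, hk, hd⟩ := hs
  have hkβ : k = extendZero (f.pderiv β hβ) := funext fun y =>
    HasIterPartialOn.unique isOpen_interior hk (f.pderiv_spec β hβ) y (by simp)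
  have := hd x (by simp)
  rwa [hkβ, ← pderivAt_eq_extendZero, extendZero_apply _ (mem_univ x)] at this

/-- The derivatives of `E f` on a compact set are controlled by finitely many derivatives of `f` on
a compact set. -/
lemma exists_pderivAt_le (hR : R ⊆ closure (interior R))
    (E : CSpace ℓ R ℝ →L[ℝ] CSpace ℓ (univ : Set (Fin d → ℝ)) ℝ) (α : Fin d → ℕ)
    (hα : (order α : ℕ∞) ≤ ℓ) {K : Set (Fin d → ℝ)} (hK : IsCompact K) :
    ∃ (S : Finset {α : Fin d → ℕ // (order α : ℕ∞) ≤ ℓ}) (L : Set R) (C : ℝ), IsCompact L ∧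
      0 < C ∧ ∀ (f : CSpace ℓ R ℝ) (δ : ℝ), 0 ≤ δ →
        (∀ β ∈ S, ∀ y ∈ L, |f.pderiv β.1 β.2 y| ≤ δ) → ∀ x ∈ K, |pderivAt α hα x (E f)| ≤ C * δ := by
  let j : (Fin d → ℝ) → (univ : Set (Fin d → ℝ)) := fun x => ⟨x, mem_univ x⟩
  have hj : Continuous j := by fun_prop
  have h0 : (E 0).pderiv α hα = 0 := by
    rw [map_zero]
    exact map_zero (pderivₗ univ_subset_closure_interior α hα)
  have hU : {f : CSpace ℓ R ℝ | MapsTo ((E f).pderiv α hα) (j '' K) (Metric.ball 0 1)} ∈ 𝓝 0 := by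
    refine ((continuous_pderiv α hα).comp E.continuous).continuousAt.eventually
      (ContinuousMap.eventually_mapsTo (hK.image hj) Metric.isOpen_ball ?_)
    intro x _
    change (E 0).pderiv α hα x ∈ Metric.ball (0 : ℝ) 1
    rw [h0]
    simp
  obtain ⟨S, L, V, hL, hV, h⟩ := exists_pderiv_mem_subset hR hU
  obtain ⟨r, hr, hrV⟩ := Metric.mem_nhds_iff.1 hV
  -- Scaling `f` by `r / (2 δ)` puts its derivatives in the ball of radius `r`; this needs `δ > 0`.
  have key : ∀ (f : CSpace ℓ R ℝ) (δ : ℝ), 0 < δ →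
      (∀ β ∈ S, ∀ y ∈ L, |f.pderiv β.1 β.2 y| ≤ δ) →
      ∀ x ∈ K, |pderivAt α hα x (E f)| ≤ 2 / r * δ := by
    intro f δ hδ hf x hx
    have hc : 0 < r / (2 * δ) := by positivity
    have hm := h ((r / (2 * δ)) • f) (fun β hβ y hy => hrV ?_) (mem_image_of_mem j hx)
    · have : |pderivAt α hα x (E ((r / (2 * δ)) • f))| < 1 :=
        mem_ball_zero_iff.1 hm
      rw [map_smul, map_smul, smul_eq_mul, abs_mul, abs_of_pos hc, div_mul_eq_mul_div,
        div_lt_one (by positivity)] at this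
      rw [div_mul_eq_mul_div, le_div_iff₀ hr]
      linarith
    · rw [← pderivₗ_apply hR, map_smul, mem_ball_zero_iff, ContinuousMap.smul_apply, norm_smul,
        Real.norm_eq_abs, Real.norm_eq_abs, abs_of_pos hc, div_mul_eq_mul_div,
        div_lt_iff₀ (by positivity)]
      have := hf β hβ y hy
      rw [← pderivₗ_apply hR] at this
      nlinarith
  refine ⟨S, L, 2 / r, hL, by positivity, fun f δ hδ hf x hx => ?_⟩
  -- The case `δ = 0` is reached by enlarging `δ` by `r / 2 * ε`, which adds exactly `ε` to the
  -- bound.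
  refine le_of_forall_pos_le_add fun ε hε => ?_
  refine (key f (δ + r / 2 * ε) (by positivity) (fun β hβ y hy => (hf β hβ y hy).trans ?_)
    x hx).trans_eq ?_
  · have : 0 < r / 2 * ε := by positivity
    linarith
  · field_simp

end Pderiv

/-! ### From weak to genuine partial derivatives -/

section WeakDerivatives

variable {d : ℕ} {F : Type*} [AddCommGroup F] [Module ℝ F] [TopologicalSpace F]
  [IsTopologicalAddGroup F] [ContinuousSMul ℝ F] [LocallyConvexSpace ℝ F]

/-- If all `l ∘ f` have the partial derivative `l ∘ g` and `g` is continuous, then `g` is the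
partial derivative of `f`. -/
lemma hasPartialAt_of_forall_dual {i : Fin d} {f g : (Fin d → ℝ) → F} (hg : Continuous g)
    (h : ∀ (l : F →L[ℝ] ℝ) x, HasPartialAt i (fun y => l (f y)) (l (g x)) x) (x : Fin d → ℝ) :
    HasPartialAt i f (g x) x := by
  set e : Fin d → ℝ := Pi.single i 1
  rw [HasPartialAt, tendsto_iff_eventually]
  intro P hP
  have hP' : ∀ᶠ w in 𝓝 (0 : F), P (w + g x) := by
    have : Continuous fun w : F => w + g x := by fun_prop
    exact this.continuousAt.eventually (by simpa using hP)
  obtain ⟨p, hp, r, hr, hpP⟩ := LocallyConvexSpace.exists_seminorm_ball_subset hP'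
  have hc : Continuous fun s : ℝ => p (g (x + s • e) - g x) :=
    hp.comp ((hg.comp (by fun_prop)).sub continuous_const)
  have hev : ∀ᶠ s : ℝ in 𝓝 0, p (g (x + s • e) - g x) < r / 2 :=
    hc.continuousAt.eventually (gt_mem_nhds (by simpa using by positivity))
  obtain ⟨η, hη, hball⟩ := Metric.eventually_nhds_iff_ball.1 hev
  filter_upwards [nhdsWithin_le_nhds (Metric.ball_mem_nhds 0 hη), self_mem_nhdsWithin] with t ht ht0
  suffices H : p (t⁻¹ • (f (x + t • e) - f x) - g x) ≤ r / 2 by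
    simpa using hpP _ (H.trans_lt (by linarith))
  refine Seminorm.le_of_forall_dual_le hp fun l hl => ?_
  -- Subtracting `s * l (g x)` leaves a derivative bounded by `p (g (x + s • e) - g x) < r / 2` on a
  -- ball whose radius `η` is independent of `l`; the mean value inequality then applies.
  have hd : ∀ s : ℝ, HasDerivAt (fun s : ℝ => l (f (x + s • e)) - s * l (g x))
      (l (g (x + s • e)) - l (g x)) s := by
    intro s
    refine HasDerivAt.sub ?_ (by simpa using (hasDerivAt_id s).mul_const (l (g x)))
    rw [hasDerivAt_iff_tendsto_slope_zero]
    refine (h l (x + s • e)).congr fun t => ?_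
    rw [add_smul, add_assoc]
  have hmv := (convex_ball (0 : ℝ) η).norm_image_sub_le_of_norm_hasDerivWithin_le
    (fun s _ => (hd s).hasDerivWithinAt) (C := r / 2) (fun s hs => ?_)
    (Metric.mem_ball_self hη) ht
  · have ht0' : 0 < |t| := abs_pos.2 ht0
    have : l (t⁻¹ • (f (x + t • e) - f x) - g x)
        = t⁻¹ * (l (f (x + t • e)) - t * l (g x) - l (f x)) := by
      have : t ≠ 0 := ht0
      simp only [map_sub, map_smul, smul_eq_mul]
      field_simp
      ring
    rw [this, abs_mul, abs_inv, inv_mul_le_iff₀ ht0', mul_comm |t|]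
    simpa using hmv
  · rw [← map_sub, Real.norm_eq_abs]
    exact (hl _).trans (hball s hs).le

/-- Functions which are weakly iterated partial derivatives are iterated partial derivatives. -/
lemma hasIterPartialOn_word {ℓ : ℕ∞}
    (W : ∀ α : Fin d → ℕ, (order α : ℕ∞) ≤ ℓ → (Fin d → ℝ) → F)
    (G : (F →L[ℝ] ℝ) → CSpace ℓ (univ : Set (Fin d → ℝ)) ℝ)
    [T2Space F] (hW : ∀ α hα x l, l (W α hα x) = pderivAt α hα x (G l))
    (hc : ∀ α hα, Continuous (W α hα)) {w : (Fin d → ℝ) → F}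
    (hw : ∀ x l, l (w x) = (G l).toCont ⟨x, mem_univ x⟩) (L : List (Fin d)) :
    ∀ α hα, word α = L → HasIterPartialOn univ L w (W α hα) := by
  induction L with
  | nil =>
    refine fun α hα hL x _ => eq_of_forall_dual_eq fun l => ?_
    rw [hW, hw, pderivAt_of_word_eq_nil hα hL]
  | cons i L ih =>
    intro α hα hL
    obtain ⟨β, rfl, hβα⟩ := exists_word_eq_tail hL
    have hβ : (order β : ℕ∞) ≤ ℓ := le_trans (by exact_mod_cast hβα) hα
    refine ⟨W β hβ, ih β hβ rfl, fun x _ => hasPartialAt_of_forall_dual (hc α hα) ?_ x⟩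
    intro l y
    simp only [hW]
    exact hasPartialAt_pderivAt hα hβ hL (G l) y

end WeakDerivatives

/-! ### Vector values of scalar functionals, and their dependence on the point and on `γ` -/

section Extension

variable {d : ℕ} {ℓ : ℕ∞} {R : Set (Fin d → ℝ)} {F : Type*} [AddCommGroup F] [Module ℝ F]

lemma continuous_prod_of_discrete {X Y ι : Type*} [TopologicalSpace X] [TopologicalSpace Y]
    [TopologicalSpace ι] [DiscreteTopology ι] {L : Set X} (k : ι → C(X, Y)) :
    Continuous fun z : ι × L => k z.1 z.2 :=
  continuous_prod_of_discrete_left.2 fun i => (k i).continuous.comp continuous_subtype_val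

/-- A continuous functional on `C^ℓ(R, ℝ)` can be applied to `γ ∈ C^ℓ(R, F)`. -/
lemma exists_forall_dual_eq_compDual [UniformSpace F] [IsUniformAddGroup F] [ContinuousSMul ℝ F]
    [LocallyConvexSpace ℝ F] (hF : ∀ u : ℕ → F, CauchySeq u → ∃ v, Tendsto u atTop (𝓝 v))
    (hR : R ⊆ closure (interior R)) (u : CSpace ℓ R ℝ →ₗ[ℝ] ℝ)
    (S : Finset {α : Fin d → ℕ // (order α : ℕ∞) ≤ ℓ}) {L : Set R} (hL : IsCompact L) {C : ℝ}
    (hC : 0 < C) (hu : ∀ (f : CSpace ℓ R ℝ) (δ : ℝ), 0 ≤ δ →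
      (∀ β ∈ S, ∀ y ∈ L, |f.pderiv β.1 β.2 y| ≤ δ) → |u f| ≤ C * δ) (γ : CSpace ℓ R F) :
    ∃ v : F, ∀ l : F →L[ℝ] ℝ, l v = u (compDual l γ) := by
  have : CompactSpace L := isCompact_iff_compactSpace.1 hL
  -- The derivatives in `S` on `L` are bundled into one continuous function, so that the hypothesis
  -- on `u` becomes `|u f| ≤ C ‖J f‖`. Hence `u` factors through the range of `J`, and Hahn-Banach
  -- extends it to `C(S × L, ℝ)`.
  let J : CSpace ℓ R ℝ →ₗ[ℝ] C(S × L, ℝ) :=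
    { toFun := fun f => ⟨fun z => f.pderiv z.1.1.1 z.1.1.2 z.2,
        continuous_prod_of_discrete fun β : S => f.pderiv β.1.1 β.1.2⟩
      map_add' := fun f g => by
        ext z
        simp [← pderivₗ_apply hR]
      map_smul' := fun c f => by
        ext z
        simp [← pderivₗ_apply hR] }
  have hJ : ∀ f, |u f| ≤ C * ‖J f‖ := fun f =>
    hu f _ (norm_nonneg _) fun β hβ y hy => (J f).norm_coe_le_norm (⟨β, hβ⟩, ⟨y, hy⟩)
  have hker : LinearMap.ker J ≤ LinearMap.ker u := fun f hf => by
    have := hJ f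
    rw [LinearMap.mem_ker.1 hf, norm_zero, mul_zero] at this
    exact abs_nonpos_iff.1 this
  let φ : Module.Dual ℝ (LinearMap.range J) :=
    ((LinearMap.ker J).liftQ u hker) ∘ₗ J.quotKerEquivRange.symm.toLinearMap
  have hφ : ∀ f, φ ⟨J f, LinearMap.mem_range_self J f⟩ = u f := by
    intro f
    have : J.quotKerEquivRange.symm ⟨J f, LinearMap.mem_range_self J f⟩
        = (LinearMap.ker J).mkQ f := J.quotKerEquivRange_symm_apply_image f _
    simp only [φ, LinearMap.comp_apply, LinearEquiv.coe_coe, this]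
    exact (LinearMap.ker J).liftQ_apply u f
  have hCn : ∀ z, (Real.toNNReal C • normSeminorm ℝ C(S × L, ℝ)) z = C * ‖z‖ := fun z => by
    rw [smul_apply, NNReal.smul_def, Real.coe_toNNReal C hC.le]
    rfl
  obtain ⟨Φ, hΦ, -⟩ := Module.Dual.exists_continuous_extension_of_le_seminorm_real
    (LinearMap.range J) φ (p := Real.toNNReal C • normSeminorm ℝ C(S × L, ℝ))
    (by
      have : Continuous fun z : C(S × L, ℝ) => C * ‖z‖ := by fun_prop
      exact this.congr fun z => (hCn z).symm)
    (by
      rintro ⟨_, f, rfl⟩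
      rw [hφ, hCn]
      exact (le_abs_self _).trans (hJ f))
  obtain ⟨v, hv⟩ := exists_forall_dual_eq_functional hF Φ
    (⟨fun z => γ.pderiv z.1.1.1 z.1.1.2 z.2,
      continuous_prod_of_discrete fun β : S => γ.pderiv β.1.1 β.1.2⟩ : C(S × L, F))
  refine ⟨v, fun l => ?_⟩
  rw [hv, ← hφ, ← hΦ]
  congr 1
  ext z
  change l (γ.pderiv z.1.1.1 z.1.1.2 z.2) = (compDual l γ).pderiv z.1.1.1 z.1.1.2 z.2
  rw [pderiv_compDual hR]
  rfl

section Estimates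

variable [TopologicalSpace F] [IsTopologicalAddGroup F] [ContinuousSMul ℝ F]
  [LocallyConvexSpace ℝ F]

/-- Each `l ∘ w` is continuous, but continuity of `w` requires uniformity over the `l` dominated by
a seminorm. Near `x₀` the values of `l ∘ w` depend, up to the constant `C`, only on `l` over the
compact set `Q`, where finitely many functionals approximate all of them. -/
lemma continuous_of_dual_eq_pderivAt (hR : R ⊆ closure (interior R))
    (E : CSpace ℓ R ℝ →L[ℝ] CSpace ℓ (univ : Set (Fin d → ℝ)) ℝ) {α : Fin d → ℕ}
    {hα : (order α : ℕ∞) ≤ ℓ} {γ : CSpace ℓ R F} {w : (Fin d → ℝ) → F}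
    (hw : ∀ x (l : F →L[ℝ] ℝ), l (w x) = pderivAt α hα x (E (compDual l γ))) :
    Continuous w := by
  rw [continuous_iff_continuousAt]
  intro x₀
  rw [ContinuousAt, tendsto_iff_eventually]
  intro P hP
  have hP' : ∀ᶠ v in 𝓝 (0 : F), P (v + w x₀) := by
    have : Continuous fun v : F => v + w x₀ := by fun_prop
    exact this.continuousAt.eventually (by simpa using hP)
  obtain ⟨p, hp, r, hr, hpP⟩ := LocallyConvexSpace.exists_seminorm_ball_subset hP'
  obtain ⟨S, L, C, hL, hC, hE⟩ := exists_pderivAt_le hR E α hα (isCompact_closedBall x₀ 1)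
  let Q : Set F := ⋃ β : S, γ.pderiv β.1.1 β.1.2 '' L
  have hQ : IsCompact Q := isCompact_iUnion fun β => hL.image (γ.pderiv β.1.1 β.1.2).continuous
  obtain ⟨T, hT, hnet⟩ := Seminorm.exists_finite_dual_net hp hQ
    (by positivity : 0 < r / (4 * C))
  have hev : ∀ᶠ x in 𝓝 x₀, ∀ l ∈ T, |l (w x) - l (w x₀)| < r / 4 := by
    refine (eventually_all_finite hT).2 fun l _ => ?_
    have hcont : Continuous fun x => l (w x) := by
      simp only [hw]
      exact continuous_pderivAt α hα _
    exact (Metric.tendsto_nhds.1 (hcont.tendsto x₀)) _ (by positivity)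
  filter_upwards [hev, Metric.closedBall_mem_nhds x₀ one_pos] with x hx hxK
  suffices H : p (w x - w x₀) ≤ 3 * (r / 4) by
    simpa using hpP _ (H.trans_lt (by linarith))
  refine Seminorm.le_of_forall_dual_le hp fun l hl => ?_
  obtain ⟨l', hl', hll⟩ := hnet l hl
  have hclose : ∀ y ∈ Metric.closedBall x₀ 1, |l (w y) - l' (w y)| ≤ r / 4 := by
    intro y hy
    have := hE (compDual (l - l') γ) (r / (4 * C)) (by positivity) (fun β hβ z hz => ?_) y hy
    · rw [compDual_sub, map_sub, map_sub, ← hw, ← hw] at this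
      refine this.trans_eq ?_
      field_simp
    · rw [pderiv_compDual hR]
      exact hll _ (mem_iUnion.2 ⟨⟨β, hβ⟩, z, hz, rfl⟩)
  have h1 := abs_le.1 (hclose x hxK)
  have h2 := abs_le.1 (hclose x₀ (Metric.mem_closedBall_self zero_le_one))
  have h3 := abs_lt.1 (hx l' hl')
  rw [map_sub, abs_le]
  constructor <;> linarith [h1.1, h1.2, h2.1, h2.2, h3.1, h3.2]

/-- If `p` is small on the derivatives of `γ` over `L`, then the derivatives of `l ∘ γ` are small
there for all `l` dominated by `p` at once. This gives continuity of `γ ↦ w γ` at `0`. -/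
lemma eventually_mapsTo_of_dual_eq_pderivAt [T2Space F] (hR : R ⊆ closure (interior R))
    (E : CSpace ℓ R ℝ →L[ℝ] CSpace ℓ (univ : Set (Fin d → ℝ)) ℝ) {α : Fin d → ℕ}
    {hα : (order α : ℕ∞) ≤ ℓ}
    {w : CSpace ℓ R F → (Fin d → ℝ) → F}
    (hw : ∀ γ x (l : F →L[ℝ] ℝ), l (w γ x) = pderivAt α hα x (E (compDual l γ)))
    {K : Set (Fin d → ℝ)} (hK : IsCompact K) {U : Set F} (hU : U ∈ 𝓝 0) :
    ∀ᶠ γ in 𝓝 (0 : CSpace ℓ R F), MapsTo (w γ) K U := by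
  obtain ⟨p, hp, r, hr, hpU⟩ := LocallyConvexSpace.exists_seminorm_ball_subset hU
  obtain ⟨S, L, C, hL, hC, hE⟩ := exists_pderivAt_le hR E α hα hK
  have hV : IsOpen {v : F | p v < r / (2 * C)} := isOpen_lt hp continuous_const
  have hev : ∀ᶠ γ in 𝓝 (0 : CSpace ℓ R F), ∀ β ∈ S,
      MapsTo (γ.pderiv β.1 β.2) L {v : F | p v < r / (2 * C)} := by
    refine (eventually_all_finset S).2 fun β _ => ?_
    refine (continuous_pderiv β.1 β.2).continuousAt.eventually
      (ContinuousMap.eventually_mapsTo hL hV fun y _ => ?_)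
    have h0 : (0 : CSpace ℓ R F).pderiv β.1 β.2 = 0 := map_zero (pderivₗ hR β.1 β.2)
    rw [h0]
    simpa using by positivity
  filter_upwards [hev] with γ hγ x hx
  refine hpU _ (lt_of_le_of_lt ?_ (half_lt_self hr))
  refine Seminorm.le_of_forall_dual_le hp fun l hl => ?_
  rw [hw]
  refine (hE (compDual l γ) (r / (2 * C)) (by positivity) (fun β hβ y hy => ?_) x hx).trans_eq ?_
  · rw [pderiv_compDual hR]
    exact (hl _).trans (le_of_lt (hγ β hβ hy))
  · field_simp

end Estimates

end Extension

end CkFun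

/-! ### Assembling the extension operator -/

theorem theorem1p3 {d : ℕ} (ℓ : ℕ∞) (R : Set (Fin d → ℝ)) (hconv : Convex ℝ R)
    (hdense : R ⊆ closure (interior R))
    (hscalar : CkFun.HasExtensionOperator ℓ R ℝ)
    (F : Type*) [AddCommGroup F] [Module ℝ F] [UniformSpace F] [IsUniformAddGroup F]
    [ContinuousSMul ℝ F] [LocallyConvexSpace ℝ F] [T2Space F]
    (hF : ∀ u : ℕ → F, CauchySeq u → ∃ v, Tendsto u atTop (𝓝 v)) :
    CkFun.HasExtensionOperator ℓ R F := by
  obtain ⟨E, hE⟩ := hscalar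
  have hex : ∀ (α : Fin d → ℕ) (hα : (CkFun.order α : ℕ∞) ≤ ℓ) (γ : CkFun.CSpace ℓ R F)
      (x : Fin d → ℝ), ∃ v : F, ∀ l : F →L[ℝ] ℝ,
        l v = CkFun.pderivAt α hα x (E (CkFun.compDual l γ)) := by
    intro α hα γ x
    obtain ⟨S, L, C, hL, hC, h⟩ :=
      CkFun.exists_pderivAt_le hdense E α hα (isCompact_singleton (x := x))
    exact CkFun.exists_forall_dual_eq_compDual hF hdense
      (CkFun.pderivAt α hα x ∘ₗ E.toLinearMap) S hL hC (fun f δ hδ hf => h f δ hδ hf x rfl) γ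
  choose W hW using hex
  have hWc : ∀ α hα γ, Continuous (W α hα γ) := fun α hα γ =>
    CkFun.continuous_of_dual_eq_pderivAt hdense E (hW α hα γ)
  have hWadd : ∀ α hα γ η x, W α hα (γ + η) x = W α hα γ x + W α hα η x := fun α hα γ η x =>
    eq_of_forall_dual_eq fun l => by simp only [hW, map_add]
  have hWsmul : ∀ α hα (c : ℝ) γ x, W α hα (c • γ) x = c • W α hα γ x := fun α hα c γ x =>
    eq_of_forall_dual_eq fun l => by simp only [hW, map_smul]
  -- The extension of `γ` is `W 0 h0 γ`; the other `W α hα γ` will be its derivatives.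
  have h0 := CkFun.order_zero_le (d := d) ℓ
  have hW0 : ∀ γ x (l : F →L[ℝ] ℝ),
      l (W 0 h0 γ x) = (E (CkFun.compDual l γ)).toCont ⟨x, mem_univ x⟩ := fun γ x l => by
    rw [hW, CkFun.pderivAt_of_word_eq_nil h0 CkFun.word_zero]
  let D : ∀ α : Fin d → ℕ, (CkFun.order α : ℕ∞) ≤ ℓ →
      CkFun.CSpace ℓ R F →ₗ[ℝ] C((univ : Set (Fin d → ℝ)), F) := fun α hα =>
    { toFun := fun γ => ⟨fun x => W α hα γ x, (hWc α hα γ).comp continuous_subtype_val⟩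
      map_add' := fun γ η => ContinuousMap.ext fun x => hWadd α hα γ η x
      map_smul' := fun c γ => ContinuousMap.ext fun x => hWsmul α hα c γ x }
  have hD : ∀ α hα γ, CkFun.IsPartialExt α (D 0 h0 γ) (D α hα γ) := by
    intro α hα γ
    refine ((CkFun.hasIterPartialOn_word (fun β hβ => W β hβ γ)
      (fun l => E (CkFun.compDual l γ)) (fun β hβ => hW β hβ γ) (fun β hβ => hWc β hβ γ)
      (hW0 γ) _ α hα rfl).mono (subset_univ _)).congr ?_ ?_ <;>
    · intro x _
      rw [CkFun.extendZero_apply _ (mem_univ x)]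
      rfl
  let EF : CkFun.CSpace ℓ R F →ₗ[ℝ] CkFun.CSpace ℓ (univ : Set (Fin d → ℝ)) F :=
    (D 0 h0).codRestrict (CkFun.ckSubmodule ℓ univ F) fun γ α hα => ⟨_, hD α hα γ⟩
  have hpd : ∀ α hα γ, (EF γ).pderiv α hα = D α hα γ := fun α hα γ =>
    CkFun.IsPartialExt.unique CkFun.univ_subset_closure_interior
      ((EF γ).pderiv_spec α hα) (hD α hα γ)
  have := CkFun.isTopologicalAddGroup_cSpace (F := F) (ℓ := ℓ) hdense
  have hDc : ∀ α hα, Continuous (D α hα) := by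
    intro α hα
    refine continuous_of_continuousAt_zero (D α hα) ?_
    rw [ContinuousAt, map_zero]
    refine ((𝓝 (0 : F)).basis_sets.nhds_continuousMapConst
      (X := (univ : Set (Fin d → ℝ)))).tendsto_right_iff.2 ?_
    rintro ⟨K, U⟩ ⟨hK, hU⟩
    filter_upwards [CkFun.eventually_mapsTo_of_dual_eq_pderivAt hdense E (hW α hα)
      (hK.image continuous_subtype_val) hU] with γ hγ x hx
    exact hγ (mem_image_of_mem _ hx)
  refine ⟨⟨EF, ?_⟩, fun γ => CkFun.CSpace.ext fun x => eq_of_forall_dual_eq fun l => ?_⟩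
  · refine continuous_iInf_rng.2 fun α => continuous_iInf_rng.2 fun hα =>
      continuous_induced_rng.2 ?_
    exact (hDc α hα).congr fun γ => (hpd α hα γ).symm
  -- On `R` the functional `l` sends the extension to `E (l ∘ γ) x = l (γ x)`, since `E` extends
  -- scalar functions.
  · exact (hW0 γ x l).trans (congrArg (fun f => f.toCont x) (hE (CkFun.compDual l γ)))
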